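/- Let $Q\subset\mathbb R^n$ be a Fano polytope, i.e. a polytope containing the origin in its interior whose vertices $p_\alpha$ are primitive vectors of $\mathbb Z^n$, and let $\triangle=\{y\in\mathbb R^n : \langle p_\alpha,y\rangle+1\ge 0 \text{ for all } \alpha\}$ be its dual polytope. Let $l$ be the unique affine function with $\int_\triangle l\,h\,dy=h(0)$ for all affine functions $h$, and suppose that $\triangle$ is relative Ding unstable, i.e. $\inf_\triangle l<0$. For functions $A$ and $g$ write $$\mathcal I_A(g)=-g(0)+\int_\triangle g\,A\,dy,\qquad \|g\|_2^2=\int_\triangle g^2\,dy .$$ Let $\mathcal C_{L^2}$ be the set of functions that are convex on the interior $\triangle^\circ$ and belong to $L^2(\triangle)$, two of them being identified if they agree on $\triangle^\circ$, and for $g\in\mathcal C_{L^2}$ put $W_l(g)=\mathcal I_l(g)/\|g\|_2$, with $W_l(0)=0$. Then there is a unique $\phi\in\mathcal C_{L^2}$ that minimises $W_l$ over $\mathcal C_{L^2}$ and satisfies $\mathcal I_l(\phi)=-\|\phi\|_2^2$. Moreover, the function $B=l+\phi$ satisfies $B\ge 0$ on $\triangle^\circ$, $\mathcal I_B(h)=0$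 for every affine function $h$, and $\int_\triangle B^2\,dy=B(0)$. -/

import Mathlib

open MeasureTheory

/-- A nonzero lattice vector that is not a proper integer multiple of another lattice vector. -/
def IsPrimitiveVector {n : ℕ} (v : Fin n → ℤ) : Prop :=
  ∀ (k : ℤ) (w : Fin n → ℤ), v = k • w → IsUnit k

/-- The inclusion of the lattice `ℤⁿ` in `ℝⁿ`. -/
def latticeToReal {n : ℕ} (v : Fin n → ℤ) : Fin n → ℝ := fun i => (v i : ℝ)

/-- A Fano polytope `Q ⊆ N_ℝ`, with `N = ℤⁿ`, given by its vertex set: the vertices are primitive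
lattice vectors and the origin is an interior point of their convex hull `Q`. Such polytopes
correspond to toric Fano varieties. -/
structure FanoPolytope (n : ℕ) where
  /-- The vertices `p_α`. -/
  verts : Finset (Fin n → ℤ)
  primitive : ∀ p ∈ verts, IsPrimitiveVector p
  extreme : (convexHull ℝ (latticeToReal '' (verts : Set (Fin n → ℤ)))).extremePoints ℝ =
    latticeToReal '' (verts : Set (Fin n → ℤ))
  zero_mem_interior : (0 : Fin n → ℝ) ∈
    interior (convexHull ℝ (latticeToReal '' (verts : Set (Fin n → ℤ))))

namespace FanoPolytope

/-- The polytope `Δ = {y ∈ M_ℝ | ⟨p_α, y⟩ + 1 ≥ 0 for all α}` of the anticanonical divisor. -/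
def dual {n : ℕ} (Q : FanoPolytope n) : Set (Fin n → ℝ) :=
  {y | ∀ p ∈ Q.verts, 0 ≤ latticeToReal p ⬝ᵥ y + 1}

theorem zero_mem_interior_dual {n : ℕ} (Q : FanoPolytope n) :
    (0 : Fin n → ℝ) ∈ interior Q.dual := by
  rw [mem_interior]
  refine ⟨⋂ p ∈ Q.verts, {y | 0 < latticeToReal p ⬝ᵥ y + 1}, ?_, ?_, ?_⟩
  · intro y hy p hp
    simp only [Set.mem_iInter, Set.mem_ofPred_eq] at hy
    exact (hy p hp).le
  · refine isOpen_biInter_finset fun p _ => isOpen_lt continuous_const ?_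
    unfold dotProduct
    fun_prop
  · simp

theorem isCompact_dual {n : ℕ} (Q : FanoPolytope n) : IsCompact Q.dual := by
  refine Metric.isCompact_of_isClosed_isBounded ?_ ?_
  · have : Q.dual = ⋂ p ∈ Q.verts, {y | 0 ≤ latticeToReal p ⬝ᵥ y + 1} := by
      ext y; simp [dual]
    rw [this]
    refine isClosed_biInter fun p _ => isClosed_le continuous_const ?_
    unfold dotProduct
    fun_prop
  · obtain ⟨ε, hε, hball⟩ := Metric.isOpen_iff.1 isOpen_interior _ Q.zero_mem_interior
    have key : ∀ y ∈ Q.dual, ∀ x ∈ convexHull ℝ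
        (latticeToReal '' (Q.verts : Set (Fin n → ℤ))), -1 ≤ x ⬝ᵥ y := by
      intro y hy x hx
      have hconv : Convex ℝ {x : Fin n → ℝ | -1 ≤ x ⬝ᵥ y} := by
        intro a ha b hb s t hs ht hst
        simp only [Set.mem_ofPred_eq, add_dotProduct, smul_dotProduct, smul_eq_mul] at *
        nlinarith
      refine convexHull_min ?_ hconv hx
      rintro _ ⟨p, hp, rfl⟩
      have := hy p hp
      simp only [Set.mem_ofPred_eq]
      linarith
    refine (Metric.isBounded_iff_subset_closedBall 0).2 ⟨2 / ε, fun y hy => ?_⟩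
    rw [mem_closedBall_zero_iff, pi_norm_le_iff_of_nonneg (by positivity)]
    intro i
    have mem : ∀ c : ℝ, |c| < ε → (Pi.single i c : Fin n → ℝ) ∈ convexHull ℝ
        (latticeToReal '' (Q.verts : Set (Fin n → ℤ))) := by
      intro c hc
      refine interior_subset (hball ?_)
      rw [mem_ball_zero_iff, Pi.norm_single]
      exact hc
    have hh : |ε / 2| < ε := by rw [abs_of_pos (by positivity)]; linarith
    have h1 := key y hy _ (mem (ε / 2) hh)
    have h2 := key y hy _ (mem (-(ε / 2)) (by rwa [abs_neg]))
    rw [single_dotProduct] at h1 h2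
    rw [Real.norm_eq_abs, abs_le]
    constructor
    · rw [neg_le, ← sub_nonneg]
      have : 2 / ε - -y i = (2 / ε) * (ε / 2 * y i + 1) := by field_simp; ring
      rw [this]
      exact mul_nonneg (by positivity) (by linarith)
    · rw [← sub_nonneg]
      have : 2 / ε - y i = (2 / ε) * (-(ε / 2) * y i + 1) := by field_simp; ring
      rw [this]
      exact mul_nonneg (by positivity) (by linarith)

/-- There is exactly one affine function `l` with `∫_Δ l h = h(0)` for all affine `h`. -/
theorem existsUnique_ricciAffine {n : ℕ} (Q : FanoPolytope n) :
    ∃! l : (Fin n → ℝ) →ᵃ[ℝ] ℝ, ∀ h : (Fin n → ℝ) →ᵃ[ℝ] ℝ,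
      ∫ y in Q.dual, l y * h y = h 0 := by
  have hint : ∀ a b : (Fin n → ℝ) →ᵃ[ℝ] ℝ,
      IntegrableOn (fun y => a y * b y) Q.dual := fun a b =>
    ((a.continuous_of_finiteDimensional.mul
      b.continuous_of_finiteDimensional).continuousOn).integrableOn_compact Q.isCompact_dual
  let e := AffineMap.toConstProdLinearMap (k := ℝ) (V1 := Fin n → ℝ) (V2 := ℝ) (R := ℝ)
  have : FiniteDimensional ℝ ((Fin n → ℝ) →ᵃ[ℝ] ℝ) := Module.Finite.equiv e.symm
  let T : ((Fin n → ℝ) →ᵃ[ℝ] ℝ) →ₗ[ℝ] Module.Dual ℝ ((Fin n → ℝ) →ᵃ[ℝ] ℝ) :=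
    LinearMap.mk₂ ℝ (fun l h => ∫ y in Q.dual, l y * h y)
      (fun a b c => by
        rw [← integral_add (hint a c) (hint b c)]
        congr 1; ext y; simp [add_mul])
      (fun r a c => by
        rw [smul_eq_mul, ← integral_const_mul]
        congr 1; ext y; simp [mul_assoc])
      (fun a b c => by
        rw [← integral_add (hint a b) (hint a c)]
        congr 1; ext y; simp [mul_add])
      (fun r a c => by
        rw [smul_eq_mul, ← integral_const_mul]
        congr 1; ext y; simp [mul_left_comm])
  have hT : ∀ l h, T l h = ∫ y in Q.dual, l y * h y := fun _ _ => rfl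
  have hinj : Function.Injective T := by
    rw [injective_iff_map_eq_zero]
    intro l hl
    have h0 : ∫ y in interior Q.dual, l y * l y = 0 := by
      refine le_antisymm ?_ (integral_nonneg fun y => mul_self_nonneg _)
      have h1 : ∫ y in Q.dual, l y * l y = 0 := by rw [← hT, hl]; rfl
      rw [← h1]
      exact setIntegral_mono_set (hint l l)
        (Filter.Eventually.of_forall fun y => mul_self_nonneg _)
        (interior_subset.eventuallyLE)
    have hc : Continuous fun y => l y * l y :=
      l.continuous_of_finiteDimensional.mul l.continuous_of_finiteDimensional
    rw [integral_eq_zero_iff_of_nonneg (fun y => mul_self_nonneg _)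
      ((hint l l).mono_set interior_subset)] at h0
    have h2 : Set.EqOn (fun y => l y * l y) 0 (interior Q.dual) :=
      Measure.eqOn_open_of_ae_eq h0 isOpen_interior hc.continuousOn continuousOn_const
    have h3 : ∀ y ∈ interior Q.dual, l y = 0 := fun y hy => mul_self_eq_zero.1 (h2 hy)
    have h4 : ((AffineSubspace.comap l (AffineSubspace.mk' (0 : ℝ) ⊥))) = ⊤ := by
      rw [eq_top_iff, ← isOpen_interior.affineSpan_eq_top ⟨0, Q.zero_mem_interior_dual⟩,
        affineSpan_le]
      intro y hy
      simp [h3 y hy, AffineSubspace.mem_mk']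
    ext y
    have : y ∈ AffineSubspace.comap l (AffineSubspace.mk' (0 : ℝ) ⊥) := by rw [h4]; trivial
    simpa [AffineSubspace.mem_mk'] using this
  have hsurj : Function.Surjective T :=
    (LinearMap.injective_iff_surjective_of_finrank_eq_finrank
      Subspace.dual_finrank_eq.symm).1 hinj
  let ev : Module.Dual ℝ ((Fin n → ℝ) →ᵃ[ℝ] ℝ) :=
    { toFun := fun h => h 0
      map_add' := fun _ _ => rfl
      map_smul' := fun _ _ => rfl }
  obtain ⟨l, hl⟩ := hsurj ev
  refine ⟨l, fun h => ?_, fun l' hl' => hinj ?_⟩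
  · rw [← hT, hl]; rfl
  · rw [hl]
    exact LinearMap.ext fun h => hl' h

/-- The Ricci affine function of `Δ`: the unique affine function `l` such that
`∫_Δ l h dy = h(0)` for every affine function `h`. -/
noncomputable def ricciAffine {n : ℕ} (Q : FanoPolytope n) : (Fin n → ℝ) →ᵃ[ℝ] ℝ :=
  Q.existsUnique_ricciAffine.choose

theorem integral_ricciAffine_mul {n : ℕ} (Q : FanoPolytope n) (h : (Fin n → ℝ) →ᵃ[ℝ] ℝ) :
    ∫ y in Q.dual, Q.ricciAffine y * h y = h 0 :=
  Q.existsUnique_ricciAffine.choose_spec.1 h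

/-- `Δ` is relative Ding unstable: `inf_Δ l < 0`. -/
def RelativeDingUnstable {n : ℕ} (Q : FanoPolytope n) : Prop :=
  sInf (Q.ricciAffine '' Q.dual) < 0

/-- The functional `I_A(g) = -g(0) + ∫_Δ g A dy`; for `A = l` it is the relative Ding invariant. -/
noncomputable def dingInvariant {n : ℕ} (Q : FanoPolytope n) (A g : (Fin n → ℝ) → ℝ) : ℝ :=
  -g 0 + ∫ y in Q.dual, g y * A y

/-- The `L²` norm on `Δ`, `‖g‖₂ = (∫_Δ g² dy)^{1/2}`, for `g ∈ L²(Δ)`. -/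
noncomputable def l2Norm {n : ℕ} (Q : FanoPolytope n) (g : (Fin n → ℝ) → ℝ) : ℝ :=
  Real.sqrt (∫ y in Q.dual, g y ^ 2)

/-- The functions that are convex on the interior of `Δ` and belong to `L²(Δ)`. Only the
restriction to the interior matters: the boundary of `Δ` is a null set. -/
def convexL2 {n : ℕ} (Q : FanoPolytope n) : Set ((Fin n → ℝ) → ℝ) :=
  {g | ConvexOn ℝ (interior Q.dual) g ∧ MemLp g 2 (volume.restrict Q.dual)}

/-- The normalized relative Ding invariant `W_l(g) = I_l(g) / ‖g‖₂`, with `W_l(0) = 0`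
(division by zero gives zero). -/
noncomputable def normalizedDing {n : ℕ} (Q : FanoPolytope n) (g : (Fin n → ℝ) → ℝ) : ℝ :=
  Q.dingInvariant Q.ricciAffine g / Q.l2Norm g

/-- `φ` minimises `W_l` among the convex `L²` functions and is normalized by
`I_l(φ) = -‖φ‖₂²`. -/
def IsNormalizedMinimiser {n : ℕ} (Q : FanoPolytope n) (φ : (Fin n → ℝ) → ℝ) : Prop :=
  φ ∈ Q.convexL2 ∧ IsMinOn Q.normalizedDing Q.convexL2 φ ∧
    Q.dingInvariant Q.ricciAffine φ = -(Q.l2Norm φ) ^ 2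

end FanoPolytope

open Filter Topology

/-! Instead of the quotient `W_l`, one minimises the strongly convex functional `‖g‖₂² / 2 + I_l(g)`
over the cone of convex `L²` functions. Varying the minimiser `φ` along the cone gives `I_l(φ) =
-‖φ‖₂²` and, with `B = l + φ`, `I_B(g) ≥ 0` for every convex `g`. All claims follow from these two
facts: Cauchy–Schwarz yields `W_l ≥ -‖φ‖₂ = W_l(φ)`, its equality case yields uniqueness, and
testing with `±h`, `B` and `max(B, 0)` yields the properties of `B`.

Existence is the analytic part. The cone is recorded as pairs `([g], g(0))` in `L² × ℝ`, so that
only its closedness and a bound `g(0) ≤ c ‖g‖₂` are needed. The bound is the sub-mean-value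
property; closedness holds because `L²` convergence of convex functions gives, along a subsequence,
pointwise convergence on the whole interior, in particular at `0`. -/

/-! ### Quadratic minimisation over a closed cone in a Hilbert space times `ℝ`. -/

theorem exists_firstOrder_minimiser_of_isClosed_cone {H : Type*} [NormedAddCommGroup H]
    [InnerProductSpace ℝ H] [CompleteSpace H] {S : Set (H × ℝ)} (hne : S.Nonempty)
    (hadd : ∀ p ∈ S, ∀ q ∈ S, p + q ∈ S) (hsmul : ∀ (c : ℝ), 0 ≤ c → ∀ p ∈ S, c • p ∈ S)
    (hclosed : IsClosed S) {c : ℝ} (hc : ∀ p ∈ S, p.2 ≤ c * ‖p.1‖) (l : H) :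
    ∃ p ∈ S, -p.2 + inner ℝ l p.1 = -‖p.1‖ ^ 2 ∧
      ∀ q ∈ S, 0 ≤ -q.2 + inner ℝ l q.1 + inner ℝ p.1 q.1 := by
  set F : H × ℝ → ℝ := fun p => ‖p.1‖ ^ 2 / 2 + inner ℝ l p.1 - p.2 with hF
  have hFc : Continuous F := by fun_prop
  have hbdd : BddBelow (F '' S) := by
    refine ⟨-(c + ‖l‖) ^ 2 / 2, ?_⟩
    rintro _ ⟨p, hp, rfl⟩
    have h1 := hc p hp
    have h2 := (abs_le.1 (abs_real_inner_le_norm l p.1)).1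
    simp only [hF]
    nlinarith [sq_nonneg (‖p.1‖ - (c + ‖l‖))]
  set m := sInf (F '' S) with hm
  have hmle : ∀ p ∈ S, m ≤ F p := fun p hp => csInf_le hbdd ⟨p, hp, rfl⟩
  obtain ⟨u, -, hu, huS⟩ := exists_seq_tendsto_sInf (hne.image F) hbdd
  choose p hpS hpu using huS
  rw [← hm] at hu
  -- Strong convexity in the Hilbert coordinate: compare with the midpoint, which lies in the cone,
  -- by the parallelogram law.
  have hpar : ∀ a ∈ S, ∀ b ∈ S, ‖a.1 - b.1‖ ^ 2 ≤ 4 * (F a - m) + 4 * (F b - m) := by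
    intro a ha b hb
    have h1 := hmle _ (hsmul (1 / 2) (by norm_num) _ (hadd a ha b hb))
    have h2 := parallelogram_law_with_norm ℝ a.1 b.1
    simp only [hF, Prod.smul_fst, Prod.smul_snd, Prod.fst_add, Prod.snd_add, norm_smul,
      inner_smul_right, inner_add_right, smul_eq_mul] at h1 ⊢
    rw [show ‖(1 / 2 : ℝ)‖ = 1 / 2 by norm_num] at h1
    nlinarith
  have hcau : CauchySeq fun k => (p k).1 := by
    rw [Metric.cauchySeq_iff]
    intro ε hε
    have h0 : ∀ᶠ k in atTop, u k < m + ε ^ 2 / 8 := hu.eventually_lt_const (by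
      have := pow_pos hε 2
      linarith)
    obtain ⟨N, hN⟩ := eventually_atTop.1 h0
    refine ⟨N, fun i hi j hj => ?_⟩
    rw [dist_eq_norm]
    refine lt_of_pow_lt_pow_left₀ 2 hε.le ?_
    have := hpar _ (hpS i) _ (hpS j)
    rw [hpu, hpu] at this
    linarith [hN i hi, hN j hj]
  obtain ⟨x, hx⟩ := cauchySeq_tendsto_of_complete hcau
  -- The real coordinate is recovered from the first coordinate and the value of `F`, both of which
  -- converge.
  have hsnd : Tendsto (fun k => (p k).2) atTop (𝓝 (‖x‖ ^ 2 / 2 + inner ℝ l x - m)) := by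
    have : (fun k => (p k).2) = fun k => ‖(p k).1‖ ^ 2 / 2 + inner ℝ l (p k).1 - u k := by
      ext k
      rw [← hpu]
      simp only [hF]
      ring
    rw [this]
    exact (((hx.norm.pow 2).div_const 2).add (tendsto_const_nhds.inner hx)).sub hu
  set q : H × ℝ := (x, ‖x‖ ^ 2 / 2 + inner ℝ l x - m) with hq
  have hqS : q ∈ S := hclosed.mem_of_tendsto (hx.prodMk_nhds hsnd) (Eventually.of_forall hpS)
  have hFq : F q = m := by simp only [hF, hq]; ring
  have hquad : ∀ a b : ℝ, (∃ δ > 0, ∀ t, 0 < t → t < δ → 0 ≤ t * a + t ^ 2 * b) → 0 ≤ a := by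
    rintro a b ⟨δ, hδ, h⟩
    by_contra! ha
    have hb : 0 < |b| + 1 := by positivity
    set t := min (δ / 2) (-a / (2 * (|b| + 1))) with ht
    have ht0 : 0 < t := lt_min (by linarith) (div_pos (by linarith) (by linarith))
    have h1 := h t ht0 ((min_le_left _ _).trans_lt (by linarith))
    have h2 : t * (2 * (|b| + 1)) ≤ -a := by
      rw [← le_div_iff₀ (by linarith)]
      exact min_le_right _ _
    have h3 : 0 ≤ t * (a + t * b) := by linarith
    have h4 := nonneg_of_mul_nonneg_right h3 ht0
    nlinarith [le_abs_self b]
  have hdir : ∀ r ∈ S, 0 ≤ -r.2 + inner ℝ l r.1 + inner ℝ q.1 r.1 := by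
    intro r hr
    refine hquad _ (‖r.1‖ ^ 2 / 2) ⟨1, one_pos, fun t ht _ => ?_⟩
    have h1 := hmle _ (hadd q hqS _ (hsmul t ht.le r hr))
    rw [← hFq] at h1
    simp only [hF, Prod.smul_fst, Prod.smul_snd, Prod.fst_add, Prod.snd_add,
      norm_add_sq_real, inner_smul_right, inner_add_right, smul_eq_mul, norm_smul, mul_pow,
      Real.norm_eq_abs, sq_abs] at h1
    linarith
  refine ⟨q, hqS, ?_, hdir⟩
  have h1 := hdir q hqS
  -- Shrinking `q` to `(1 - t) • q` stays in the cone, so the radial derivative vanishes.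
  have h2 : 0 ≤ -(-q.2 + inner ℝ l q.1 + inner ℝ q.1 q.1) := by
    refine hquad _ (‖q.1‖ ^ 2 / 2) ⟨1, one_pos, fun t ht ht1 => ?_⟩
    have h1 := hmle _ (hsmul (1 - t) (by linarith) q hqS)
    rw [← hFq] at h1
    simp only [hF, Prod.smul_fst, Prod.smul_snd, inner_smul_right, smul_eq_mul, norm_smul,
      mul_pow, Real.norm_eq_abs, sq_abs] at h1
    rw [real_inner_self_eq_norm_sq]
    linarith
  rw [real_inner_self_eq_norm_sq] at h1 h2
  linarith

/-! ### Local bounds and compactness for convex functions. -/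

section Convex
variable {E : Type*} [NormedAddCommGroup E] [NormedSpace ℝ E]

/-- Average the midpoint inequality for `w` and its reflection `2z - w`; the reflection preserves
the ball and the measure. -/
theorem ConvexOn.mul_measureReal_closedBall_le_setIntegral [FiniteDimensional ℝ E]
    [MeasurableSpace E] [BorelSpace E] {ν : Measure E} [ν.IsAddHaarMeasure] {f : E → ℝ}
    {z : E} {r : ℝ}
    (hf : ConvexOn ℝ (Metric.closedBall z r) f) (hi : IntegrableOn f (Metric.closedBall z r) ν) :
    f z * ν.real (Metric.closedBall z r) ≤ ∫ w in Metric.closedBall z r, f w ∂ν := by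
  set b := Metric.closedBall z r with hb
  have hbm : MeasurableSet b := Metric.isClosed_closedBall.measurableSet
  have hrefl : ∀ w, z + z - w ∈ b ↔ w ∈ b := by
    intro w
    rw [hb, Metric.mem_closedBall, Metric.mem_closedBall, dist_eq_norm, dist_eq_norm,
      show z + z - w - z = -(w - z) by abel, norm_neg]
  have hbint : Integrable (b.indicator f) ν := (integrable_indicator_iff hbm).2 hi
  have hfin : ν b ≠ ⊤ := (isCompact_closedBall z r).measure_ne_top
  have hle : ∫ w, b.indicator (fun _ => 2 * f z) w ∂ν ≤
      ∫ w, (b.indicator f w + b.indicator f (z + z - w)) ∂ν := by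
    refine integral_mono ((integrable_indicator_iff hbm).2 (integrableOn_const hfin))
      (hbint.add (hbint.comp_sub_left (z + z))) fun w => ?_
    by_cases hw : w ∈ b
    · have h1 := hf.2 hw ((hrefl w).2 hw) one_half_pos.le
        one_half_pos.le (add_halves (1 : ℝ))
      rw [show (1 / 2 : ℝ) • w + (1 / 2 : ℝ) • (z + z - w) = z by module] at h1
      simp only [Set.indicator_of_mem hw, Set.indicator_of_mem ((hrefl w).2 hw), smul_eq_mul] at h1 ⊢
      linarith
    · simp [Set.indicator_of_notMem hw, Set.indicator_of_notMem (fun h => hw ((hrefl w).1 h))]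
  rw [integral_add hbint (hbint.comp_sub_left (z + z)),
    integral_sub_left_eq_self (b.indicator f) ν (z + z), integral_indicator hbm,
    integral_indicator hbm, setIntegral_const, smul_eq_mul] at hle
  linarith

/-- Cauchy–Schwarz against the indicator of the ball. The constants depend only on `r`, so the upper
bound is uniform in `z`. -/
theorem ConvexOn.mul_measureReal_closedBall_le_mul_norm_toLp [FiniteDimensional ℝ E]
    [MeasurableSpace E] [BorelSpace E] {ν : Measure E} [ν.IsAddHaarMeasure] {f : E → ℝ}
    {z : E} {r : ℝ} {K : Set E} (hK : Metric.closedBall z r ⊆ K) (hf : ConvexOn ℝ (Metric.closedBall z r) f)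
    (hL : MemLp f 2 (ν.restrict K)) :
    f z * ν.real (Metric.closedBall (0 : E) r) ≤
      √(ν.real (Metric.closedBall (0 : E) r)) * ‖hL.toLp f‖ := by
  have hbm : MeasurableSet (Metric.closedBall z r) := Metric.isClosed_closedBall.measurableSet
  have hres : (ν.restrict K).restrict (Metric.closedBall z r) =
      ν.restrict (Metric.closedBall z r) := by
    rw [Measure.restrict_restrict hbm, Set.inter_eq_left.2 hK]
  have hfin : ν (Metric.closedBall z r) ≠ ⊤ := (isCompact_closedBall z r).measure_ne_top
  have hmeas : (ν.restrict K) (Metric.closedBall z r) = ν (Metric.closedBall z r) := by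
    rw [Measure.restrict_apply hbm, Set.inter_eq_left.2 hK]
  have hvol : ν.real (Metric.closedBall z r) = ν.real (Metric.closedBall (0 : E) r) := by
    rw [measureReal_def, measureReal_def, Measure.addHaar_closedBall_center]
  have hi : IntegrableOn f (Metric.closedBall z r) ν := by
    have h1 : MemLp f 2 (ν.restrict (Metric.closedBall z r)) := hres ▸ hL.restrict _
    have : IsFiniteMeasure (ν.restrict (Metric.closedBall z r)) :=
      ⟨by rwa [Measure.restrict_apply_univ, lt_top_iff_ne_top]⟩
    exact h1.integrable one_le_two
  have h1 := hf.mul_measureReal_closedBall_le_setIntegral hi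
  rw [hvol] at h1
  refine h1.trans ?_
  have h2 := L2.inner_indicatorConstLp_one (𝕜 := ℝ) hbm (hmeas ▸ hfin) (hL.toLp f)
  have h3 : ∫ w in Metric.closedBall z r, f w ∂ν =
      ∫ w in Metric.closedBall z r, hL.toLp f w ∂(ν.restrict K) := by
    rw [← hres]
    exact integral_congr_ae (ae_restrict_of_ae hL.coeFn_toLp.symm)
  rw [h3, ← h2]
  refine (real_inner_le_norm _ _).trans_eq ?_
  rw [norm_indicatorConstLp (by norm_num) (by norm_num)]
  rw [norm_one, one_mul, measureReal_def, hmeas, ← measureReal_def, hvol, Real.sqrt_eq_rpow]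
  norm_num

/-- The bounds make the sequence uniformly Lipschitz near `y`, and an `ε/3` argument then transfers
convergence from the dense set. -/
theorem ConvexOn.exists_tendsto_of_tendsto_dense {U : Set E} (hU : IsOpen U) {f : ℕ → E → ℝ}
    (hf : ∀ k, ConvexOn ℝ U (f k))
    (hbd : ∀ r > 0, ∃ M, ∀ k z, Metric.closedBall z r ⊆ U → f k z ≤ M) {S : Set E}
    (hS : U ⊆ closure S) (hlim : ∀ s ∈ S, ∃ a, Tendsto (fun k => f k s) atTop (𝓝 a))
    {y : E} (hy : y ∈ U) : ∃ a, Tendsto (fun k => f k y) atTop (𝓝 a) := by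
  obtain ⟨R, hR, hRU⟩ := Metric.isOpen_iff.1 hU y hy
  obtain ⟨M, hM⟩ := hbd (R / 4) (by linarith)
  obtain ⟨s, hsS, hys⟩ := Metric.mem_closure_iff.1 (hS hy) (R / 8) (by linarith)
  obtain ⟨a, ha⟩ := hlim s hsS
  obtain ⟨M', hM'⟩ := ha.abs.bddAbove_range
  have hM' : ∀ k, |f k s| ≤ M' := fun k => hM' ⟨k, rfl⟩
  have hsub : Metric.ball s (R / 4) ⊆ U := fun w hw => hRU (by
    rw [Metric.mem_ball] at *
    have := dist_triangle w s y
    rw [dist_comm s y] at this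
    linarith)
  have hup : ∀ k w, dist w s < R / 4 → f k w ≤ M := fun k w hw => hM k w fun v hv => hRU (by
    rw [Metric.mem_closedBall] at hv
    rw [Metric.mem_ball]
    have h1 := dist_triangle v w y
    have h2 := dist_triangle w s y
    rw [dist_comm s y] at h2
    linarith)
  -- The lower bound comes from reflecting through `s`: `f w ≥ 2 f(s) - f(2s - w)`, where `f(s)` is
  -- bounded along the sequence.
  have habs : ∀ k w, dist w s < R / 4 → |f k w| ≤ |M| + 2 * M' := by
    intro k w hw
    have hw' : dist (s + s - w) s < R / 4 := by
      rw [dist_eq_norm, show s + s - w - s = -(w - s) by abel, norm_neg, ← dist_eq_norm]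
      exact hw
    have h1 := (hf k).2 (hsub hw) (hsub hw') one_half_pos.le
        one_half_pos.le (add_halves (1 : ℝ))
    rw [show (1 / 2 : ℝ) • w + (1 / 2 : ℝ) • (s + s - w) = s by module, smul_eq_mul,
      smul_eq_mul] at h1
    have h2 := hup k _ hw
    have h3 := hup k _ hw'
    have h4 := abs_le.1 (hM' k)
    rw [abs_le]
    constructor <;> linarith [le_abs_self M, abs_nonneg (f k s)]
  have hlip : ∀ k, LipschitzOnWith (2 * (|M| + 2 * M') / (R / 8)).toNNReal (f k)
      (Metric.ball s (R / 4 - R / 8)) := fun k =>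
    ((hf k).subset hsub (convex_ball _ _)).lipschitzOnWith_of_abs_le (by linarith)
      (habs k)
  set L := (2 * (|M| + 2 * M') / (R / 8)).toNNReal
  have hyb : y ∈ Metric.ball s (R / 4 - R / 8) := by rw [Metric.mem_ball]; linarith
  refine cauchySeq_tendsto_of_complete (Metric.cauchySeq_iff.2 fun ε hε => ?_)
  obtain ⟨δ, hδ, hδb⟩ := Metric.isOpen_iff.1 Metric.isOpen_ball y hyb
  have hL : 0 < (L : ℝ) + 1 := by positivity
  obtain ⟨t, htS, hyt⟩ := Metric.mem_closure_iff.1 (hS hy) (min δ (ε / (3 * (L + 1))))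
    (lt_min hδ (by positivity))
  have htb := hδb (show t ∈ Metric.ball y δ by
    rw [Metric.mem_ball, dist_comm]
    exact hyt.trans_le (min_le_left _ _))
  have hLd : (L : ℝ) * dist y t ≤ ε / 3 := by
    have h1 := (lt_div_iff₀ (by positivity)).1 (hyt.trans_le (min_le_right _ _))
    nlinarith [dist_nonneg (x := y) (y := t)]
  obtain ⟨a', ha'⟩ := hlim t htS
  obtain ⟨N, hN⟩ := Metric.cauchySeq_iff.1 ha'.cauchySeq (ε / 3) (by linarith)
  refine ⟨N, fun i hi j hj => ?_⟩
  have h1 := ((hlip i).dist_le_mul y hyb t htb).trans hLd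
  have h2 := ((hlip j).dist_le_mul t htb y hyb)
  rw [dist_comm t y] at h2
  linarith [hN i hi j hj, dist_triangle4 (f i y) (f i t) (f j t) (f j y)]

theorem ConvexOn.exists_subseq_tendsto_of_tendsto_toLp [FiniteDimensional ℝ E]
    [MeasurableSpace E] [BorelSpace E] {ν : Measure E} [ν.IsAddHaarMeasure] {K : Set E}
    (hK : ν.restrict K = ν.restrict (interior K)) (hconv : Convex ℝ (interior K)) {f : ℕ → E → ℝ}
    (hf : ∀ k, ConvexOn ℝ (interior K) (f k)) (hL : ∀ k, MemLp (f k) 2 (ν.restrict K))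
    {x : Lp ℝ 2 (ν.restrict K)} (hx : Tendsto (fun k => (hL k).toLp (f k)) atTop (𝓝 x)) :
    ∃ (g : E → ℝ) (ns : ℕ → ℕ), StrictMono ns ∧ ConvexOn ℝ (interior K) g ∧
      g =ᵐ[ν.restrict K] x ∧ ∀ y ∈ interior K, Tendsto (fun k => f (ns k) y) atTop (𝓝 (g y)) := by
  obtain ⟨ns, hns, hae⟩ := (tendstoInMeasure_of_tendsto_Lp hx).exists_seq_tendsto_ae
  have hae' : ∀ᵐ y ∂(ν.restrict K), Tendsto (fun k => f (ns k) y) atTop (𝓝 (x y)) := by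
    filter_upwards [hae, ae_all_iff.2 fun k => (hL k).coeFn_toLp] with y h1 h2
    simpa only [h2] using h1
  set S : Set E := {y | Tendsto (fun k => f (ns k) y) atTop (𝓝 (x y))}
  -- A set of full measure is dense, so almost everywhere convergence suffices.
  have hS : interior K ⊆ closure S := by
    have hae' := (ae_restrict_iff' isOpen_interior.measurableSet).1 (ae_mono hK.ge hae')
    have hd : Dense {y | y ∈ interior K → Tendsto (fun k => f (ns k) y) atTop (𝓝 (x y))} :=
      Measure.dense_of_ae hae'
    refine (hd.open_subset_closure_inter isOpen_interior).trans (closure_mono ?_)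
    exact fun y hy => hy.2 hy.1
  obtain ⟨A, hA⟩ := hx.norm.bddAbove_range
  have hbd : ∀ r > 0, ∃ M, ∀ k z, Metric.closedBall z r ⊆ interior K → f (ns k) z ≤ M := by
    intro r hr
    have hpos : 0 < ν.real (Metric.closedBall (0 : E) r) :=
      ENNReal.toReal_pos (Metric.measure_closedBall_pos ν _ hr).ne'
        (isCompact_closedBall _ _).measure_ne_top
    refine ⟨√(ν.real (Metric.closedBall (0 : E) r)) * A /
      ν.real (Metric.closedBall (0 : E) r), fun k z hz => ?_⟩
    rw [le_div_iff₀ hpos]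
    have hfz := (hf (ns k)).subset hz (convex_closedBall _ _)
    refine (hfz.mul_measureReal_closedBall_le_mul_norm_toLp (hz.trans interior_subset) (hL (ns k))).trans ?_
    gcongr
    exact hA ⟨ns k, rfl⟩
  have hlim : ∀ y, ∃ a, y ∈ interior K → Tendsto (fun k => f (ns k) y) atTop (𝓝 a) := by
    intro y
    by_cases hy : y ∈ interior K
    · obtain ⟨a, ha⟩ := ConvexOn.exists_tendsto_of_tendsto_dense isOpen_interior
        (fun k => hf (ns k)) hbd hS (fun s hs => ⟨_, hs⟩) hy
      exact ⟨a, fun _ => ha⟩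
    · exact ⟨0, fun h => absurd h hy⟩
  choose g hg using hlim
  refine ⟨g, ns, hns, ⟨hconv, fun a ha b hb s t hs ht hst => ?_⟩, ?_, hg⟩
  · exact le_of_tendsto_of_tendsto' (hg _ (hconv ha hb hs ht hst))
      (((hg a ha).const_smul s).add ((hg b hb).const_smul t))
      fun k => (hf (ns k)).2 ha hb hs ht hst
  · have hin : ∀ᵐ y ∂(ν.restrict K), y ∈ interior K := by
      rw [hK]
      exact ae_restrict_mem isOpen_interior.measurableSet
    filter_upwards [hae', hin] with y h1 h2
    exact tendsto_nhds_unique (hg y h2) h1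

end Convex
-- The cone of convex `L²` functions on the dual polytope.
namespace FanoPolytope

variable {n : ℕ} (Q : FanoPolytope n)

theorem convex_dual : Convex ℝ Q.dual := by
  intro a ha b hb s t hs ht hst p hp
  have h1 := ha p hp
  have h2 := hb p hp
  simp only [dotProduct_add, dotProduct_smul, smul_eq_mul]
  nlinarith

theorem restrict_dual_eq_restrict_interior :
    volume.restrict Q.dual = volume.restrict (interior Q.dual) := by
  refine (Measure.restrict_congr_set (ae_eq_of_subset_of_measure_ge interior_subset ?_
    isOpen_interior.measurableSet.nullMeasurableSet Q.isCompact_dual.measure_ne_top)).symm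
  calc volume Q.dual ≤ volume (interior Q.dual ∪ frontier Q.dual) :=
        measure_mono (subset_closure.trans (closure_eq_interior_union_frontier _).subset)
    _ ≤ volume (interior Q.dual) + volume (frontier Q.dual) := measure_union_le _ _
    _ = volume (interior Q.dual) := by rw [Q.convex_dual.addHaar_frontier volume, add_zero]

theorem eqOn_interior_of_ae_eq {f g : (Fin n → ℝ) → ℝ} (hf : ConvexOn ℝ (interior Q.dual) f)
    (hg : ConvexOn ℝ (interior Q.dual) g) (h : f =ᵐ[volume.restrict Q.dual] g) :
    Set.EqOn f g (interior Q.dual) := by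
  rw [restrict_dual_eq_restrict_interior] at h
  exact Measure.eqOn_open_of_ae_eq h isOpen_interior (hf.continuousOn isOpen_interior)
    (hg.continuousOn isOpen_interior)

instance isFiniteMeasure_restrict_dual : IsFiniteMeasure (volume.restrict Q.dual) :=
  ⟨by simpa using Q.isCompact_dual.measure_lt_top⟩

theorem affine_mem_convexL2 (h : (Fin n → ℝ) →ᵃ[ℝ] ℝ) : ⇑h ∈ Q.convexL2 := by
  constructor
  · refine ⟨Q.convex_dual.interior, fun a _ b _ s t _ _ hst => le_of_eq ?_⟩
    exact Convex.combo_affine_apply hst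
  · obtain ⟨C, hC⟩ :=
      (Q.isCompact_dual.image h.continuous_of_finiteDimensional).isBounded.exists_norm_le
    refine MemLp.of_bound h.continuous_of_finiteDimensional.aestronglyMeasurable C ?_
    filter_upwards [ae_restrict_mem Q.isCompact_dual.measurableSet] with y hy
    exact hC _ ⟨y, hy, rfl⟩

theorem add_mem_convexL2 {f g : (Fin n → ℝ) → ℝ} (hf : f ∈ Q.convexL2) (hg : g ∈ Q.convexL2) :
    f + g ∈ Q.convexL2 :=
  ⟨hf.1.add hg.1, hf.2.add hg.2⟩

theorem smul_mem_convexL2 {c : ℝ} (hc : 0 ≤ c) {f : (Fin n → ℝ) → ℝ} (hf : f ∈ Q.convexL2) :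
    c • f ∈ Q.convexL2 :=
  ⟨hf.1.smul hc, hf.2.const_smul c⟩

theorem integral_mul_eq_inner_toLp {f g : (Fin n → ℝ) → ℝ}
    (hf : MemLp f 2 (volume.restrict Q.dual)) (hg : MemLp g 2 (volume.restrict Q.dual)) :
    ∫ y in Q.dual, g y * f y = inner ℝ (hf.toLp f) (hg.toLp g) := by
  rw [L2.inner_def]
  refine integral_congr_ae ?_
  filter_upwards [hf.coeFn_toLp, hg.coeFn_toLp] with y h1 h2
  simp [h1, h2]

theorem sq_norm_toLp {f : (Fin n → ℝ) → ℝ} (hf : MemLp f 2 (volume.restrict Q.dual)) :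
    ‖hf.toLp f‖ ^ 2 = ∫ y in Q.dual, f y ^ 2 := by
  rw [← real_inner_self_eq_norm_sq, ← integral_mul_eq_inner_toLp]
  simp only [sq]

theorem l2Norm_eq_norm_toLp {f : (Fin n → ℝ) → ℝ} (hf : MemLp f 2 (volume.restrict Q.dual)) :
    Q.l2Norm f = ‖hf.toLp f‖ := by
  rw [l2Norm, ← Q.sq_norm_toLp hf, Real.sqrt_sq (norm_nonneg _)]

theorem dingInvariant_eq_inner {A g : (Fin n → ℝ) → ℝ}
    (hA : MemLp A 2 (volume.restrict Q.dual)) (hg : MemLp g 2 (volume.restrict Q.dual)) :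
    Q.dingInvariant A g = -g 0 + inner ℝ (hA.toLp A) (hg.toLp g) := by
  rw [dingInvariant, Q.integral_mul_eq_inner_toLp hA hg]

/-- The pairs `([g], g(0))` with `g` convex on the interior and in `L²`. -/
def convexCone : Set (Lp ℝ 2 (volume.restrict Q.dual) × ℝ) :=
  {p | ∃ g, ∃ hg : g ∈ Q.convexL2, p = (hg.2.toLp g, g 0)}

theorem isClosed_convexCone : IsClosed Q.convexCone := by
  refine IsSeqClosed.isClosed fun u p hu hp => ?_
  choose f hf huf using hu
  have h1 : Tendsto (fun k => (hf k).2.toLp (f k)) atTop (𝓝 p.1) := by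
    simpa only [Function.comp_def, huf] using (continuous_fst.tendsto p).comp hp
  have h2 : Tendsto (fun k => f k 0) atTop (𝓝 p.2) := by
    simpa only [Function.comp_def, huf] using (continuous_snd.tendsto p).comp hp
  obtain ⟨g, ns, hns, hgc, hge, hg⟩ := ConvexOn.exists_subseq_tendsto_of_tendsto_toLp
    Q.restrict_dual_eq_restrict_interior Q.convex_dual.interior (fun k => (hf k).1)
    (fun k => (hf k).2) h1
  have hgL : MemLp g 2 (volume.restrict Q.dual) := (memLp_congr_ae hge).2 (Lp.memLp p.1)
  refine ⟨g, ⟨hgc, hgL⟩, Prod.ext ?_ ?_⟩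
  · exact Lp.ext (hge.symm.trans hgL.coeFn_toLp.symm)
  · exact tendsto_nhds_unique (h2.comp hns.tendsto_atTop) (hg 0 Q.zero_mem_interior_dual)

theorem exists_apply_zero_le_mul_norm_toLp :
    ∃ c : ℝ, ∀ (g : (Fin n → ℝ) → ℝ) (hg : g ∈ Q.convexL2), g 0 ≤ c * ‖hg.2.toLp g‖ := by
  obtain ⟨r, hr, hrU⟩ := Metric.nhds_basis_closedBall.mem_iff.1
    (isOpen_interior.mem_nhds Q.zero_mem_interior_dual)
  have hpos : 0 < volume.real (Metric.closedBall (0 : Fin n → ℝ) r) :=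
    ENNReal.toReal_pos (Metric.measure_closedBall_pos volume _ hr).ne'
      (isCompact_closedBall _ _).measure_ne_top
  refine ⟨√(volume.real (Metric.closedBall (0 : Fin n → ℝ) r)) /
    volume.real (Metric.closedBall (0 : Fin n → ℝ) r), fun g hg => ?_⟩
  rw [div_mul_eq_mul_div, le_div_iff₀ hpos]
  exact (hg.1.subset hrU (convex_closedBall _ _)).mul_measureReal_closedBall_le_mul_norm_toLp
    (hrU.trans interior_subset) hg.2

/-- First order optimality conditions for the minimiser of `‖g‖₂² / 2 + I_l(g)`. -/
theorem exists_firstOrder_minimiser :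
    ∃ φ, ∃ hφ : φ ∈ Q.convexL2,
      Q.dingInvariant Q.ricciAffine φ = -‖hφ.2.toLp φ‖ ^ 2 ∧
      ∀ g, ∀ hg : g ∈ Q.convexL2,
        0 ≤ Q.dingInvariant Q.ricciAffine g + inner ℝ (hφ.2.toLp φ) (hg.2.toLp g) := by
  obtain ⟨c, hc⟩ := Q.exists_apply_zero_le_mul_norm_toLp
  have hl := Q.affine_mem_convexL2 Q.ricciAffine
  obtain ⟨-, ⟨φ, hφ, rfl⟩, h1, h2⟩ := exists_firstOrder_minimiser_of_isClosed_cone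
    (S := Q.convexCone) ⟨_, _, hl, rfl⟩
    (by
      rintro _ ⟨f, hf, rfl⟩ _ ⟨g, hg, rfl⟩
      exact ⟨f + g, Q.add_mem_convexL2 hf hg, rfl⟩)
    (by
      rintro a ha _ ⟨f, hf, rfl⟩
      exact ⟨a • f, Q.smul_mem_convexL2 ha hf, rfl⟩)
    Q.isClosed_convexCone (c := c)
    (by
      rintro _ ⟨g, hg, rfl⟩
      exact hc g hg)
    (hl.2.toLp _)
  refine ⟨φ, hφ, ?_, fun g hg => ?_⟩
  · rw [Q.dingInvariant_eq_inner hl.2 hφ.2]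
    exact h1
  · rw [Q.dingInvariant_eq_inner hl.2 hg.2]
    exact h2 _ ⟨g, hg, rfl⟩

end FanoPolytope

/-! ### The minimiser and the properties of `B`. -/

open FanoPolytope in
theorem mainTheorem2 (n : ℕ) (Q : FanoPolytope n) (hQ : Q.RelativeDingUnstable) :
    ∃ φ B : (Fin n → ℝ) → ℝ,
      Q.IsNormalizedMinimiser φ ∧
      (∀ ψ : (Fin n → ℝ) → ℝ, Q.IsNormalizedMinimiser ψ →
        Set.EqOn ψ φ (interior Q.dual)) ∧
      (∀ y, B y = Q.ricciAffine y + φ y) ∧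
      (∀ y ∈ interior Q.dual, 0 ≤ B y) ∧
      (∀ h : (Fin n → ℝ) →ᵃ[ℝ] ℝ, Q.dingInvariant B h = 0) ∧
      ∫ y in Q.dual, B y ^ 2 = B 0 := by
  obtain ⟨φ, hφ, hφn, hφg⟩ := Q.exists_firstOrder_minimiser
  have hl := Q.affine_mem_convexL2 Q.ricciAffine
  set B : (Fin n → ℝ) → ℝ := Q.ricciAffine + φ with hBdef
  have hB : B ∈ Q.convexL2 := Q.add_mem_convexL2 hl hφ
  have hBsplit : ∀ g, ∀ hg : g ∈ Q.convexL2, Q.dingInvariant B g =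
      Q.dingInvariant Q.ricciAffine g + inner ℝ (hφ.2.toLp φ) (hg.2.toLp g) := by
    intro g hg
    rw [Q.dingInvariant_eq_inner hB.2 hg.2, Q.dingInvariant_eq_inner hl.2 hg.2, add_assoc,
      ← inner_add_left]
    rfl
  have hBpos : ∀ g ∈ Q.convexL2, 0 ≤ Q.dingInvariant B g := fun g hg => by
    rw [hBsplit g hg]
    exact hφg g hg
  have hW : ∀ g, ∀ hg : g ∈ Q.convexL2, -‖hφ.2.toLp φ‖ ≤ Q.normalizedDing g := by
    intro g hg
    rw [normalizedDing, Q.l2Norm_eq_norm_toLp hg.2]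
    rcases (norm_nonneg (hg.2.toLp g)).eq_or_lt with h0 | h0
    · rw [← h0, div_zero]
      exact neg_nonpos.2 (norm_nonneg _)
    · rw [le_div_iff₀ h0]
      linarith [hφg g hg, real_inner_le_norm (hφ.2.toLp φ) (hg.2.toLp g)]
  have hWn : ∀ g, ∀ hg : g ∈ Q.convexL2,
      Q.dingInvariant Q.ricciAffine g = -(Q.l2Norm g) ^ 2 →
      Q.normalizedDing g = -‖hg.2.toLp g‖ := by
    intro g hg h
    rw [normalizedDing, h, Q.l2Norm_eq_norm_toLp hg.2]
    rcases eq_or_ne ‖hg.2.toLp g‖ 0 with h0 | h0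
    · simp [h0]
    · field_simp
  have hφnorm : Q.dingInvariant Q.ricciAffine φ = -(Q.l2Norm φ) ^ 2 := by
    rw [hφn, Q.l2Norm_eq_norm_toLp hφ.2]
  -- Both `h` and `-h` are convex.
  have haff : ∀ h : (Fin n → ℝ) →ᵃ[ℝ] ℝ, Q.dingInvariant B h = 0 := by
    intro h
    have h1 := hBpos _ (Q.affine_mem_convexL2 h)
    have h2 := hBpos _ (Q.affine_mem_convexL2 (-h))
    have h3 : Q.dingInvariant B (-h : (Fin n → ℝ) →ᵃ[ℝ] ℝ) = -Q.dingInvariant B h := by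
      simp only [dingInvariant, AffineMap.coe_neg, Pi.neg_apply, neg_mul, integral_neg]
      ring
    linarith
  have hBB : Q.dingInvariant B B = 0 := by
    have h1 := haff Q.ricciAffine
    have h2 : Q.dingInvariant B φ = 0 := by
      rw [hBsplit φ hφ, hφn, real_inner_self_eq_norm_sq]
      ring
    rw [Q.dingInvariant_eq_inner hB.2 hl.2] at h1
    rw [Q.dingInvariant_eq_inner hB.2 hφ.2] at h2
    have h3 : Q.dingInvariant B B = -(Q.ricciAffine 0 + φ 0) +
        inner ℝ (hB.2.toLp B) (hl.2.toLp _ + hφ.2.toLp φ) := Q.dingInvariant_eq_inner hB.2 hB.2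
    rw [h3, inner_add_right]
    linarith
  refine ⟨φ, B, ⟨hφ, fun g hg => ?_, hφnorm⟩, fun ψ hψ => ?_, fun y => rfl, ?_, haff, ?_⟩
  · show Q.normalizedDing φ ≤ Q.normalizedDing g
    rw [hWn φ hφ hφnorm]
    exact hW g hg
  · obtain ⟨hψC, hψmin, hψn⟩ := hψ
    have h1 : Q.normalizedDing ψ ≤ Q.normalizedDing φ := hψmin hφ
    have h2 := hW ψ hψC
    rw [hWn ψ hψC hψn] at h1 h2
    rw [hWn φ hφ hφnorm] at h1
    have h3 : ‖hψC.2.toLp ψ‖ = ‖hφ.2.toLp φ‖ := by linarith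
    have h4 := hφg ψ hψC
    rw [hψn, Q.l2Norm_eq_norm_toLp hψC.2, h3] at h4
    -- The norms agree and the first-order inequality gives `⟨φ, ψ⟩ ≥ ‖φ‖₂²`: equality in
    -- Cauchy–Schwarz.
    have h5 : ‖hφ.2.toLp φ - hψC.2.toLp ψ‖ ^ 2 ≤ 0 := by
      rw [norm_sub_sq_real, h3]
      linarith
    have h6 := sub_eq_zero.1 (norm_eq_zero.1
      (pow_eq_zero_iff two_ne_zero |>.1 (le_antisymm h5 (sq_nonneg _))))
    exact Q.eqOn_interior_of_ae_eq hψC.1 hφ.1 ((MemLp.toLp_eq_toLp_iff _ _).1 h6.symm)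
  · have hzero : (0 : (Fin n → ℝ) → ℝ) ∈ Q.convexL2 :=
      ⟨convexOn_const 0 Q.convex_dual.interior, MemLp.zero⟩
    -- Test with `B⁺ = max(B, 0)`: since `I_B(B) = 0` and `B(0) ≤ B⁺(0)`, one gets `0 ≤ I_B(B⁺) -
    -- I_B(B) ≤ -‖B⁺ - B‖₂²`, so `B = B⁺` almost everywhere, and on the interior by continuity.
    have hP : B ⊔ 0 ∈ Q.convexL2 := ⟨hB.1.sup hzero.1, hB.2.sup hzero.2⟩
    have h1 := hBpos _ hP
    rw [Q.dingInvariant_eq_inner hB.2 hP.2] at h1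
    rw [Q.dingInvariant_eq_inner hB.2 hB.2] at hBB
    have hN : MemLp (B ⊔ 0 - B) 2 (volume.restrict Q.dual) := hP.2.sub hB.2
    have h2 : inner ℝ (hB.2.toLp B) (hN.toLp _) = -‖hN.toLp _‖ ^ 2 := by
      rw [← Q.integral_mul_eq_inner_toLp, Q.sq_norm_toLp, ← integral_neg]
      refine integral_congr_ae (Eventually.of_forall fun y => ?_)
      simp only [Pi.sub_apply, Pi.sup_apply, Pi.zero_apply]
      rcases le_total (B y) 0 with h | h
      · rw [sup_of_le_right h]; ring
      · rw [sup_of_le_left h]; ring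
    have h3 : inner ℝ (hB.2.toLp B) (hN.toLp _) =
        inner ℝ (hB.2.toLp B) (hP.2.toLp _) - inner ℝ (hB.2.toLp B) (hB.2.toLp B) :=
      inner_sub_right (hB.2.toLp B) (hP.2.toLp _) (hB.2.toLp B)
    have h4 : B 0 ≤ (B ⊔ 0) 0 := le_sup_left
    have h5 : ‖hN.toLp _‖ ^ 2 ≤ 0 := by linarith
    have h6 : hP.2.toLp _ - hB.2.toLp B = 0 := norm_eq_zero.1
      (pow_eq_zero_iff two_ne_zero |>.1 (le_antisymm h5 (sq_nonneg _)))
    have h7 := Q.eqOn_interior_of_ae_eq hP.1 hB.1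
      ((MemLp.toLp_eq_toLp_iff _ _).1 (sub_eq_zero.1 h6))
    intro y hy
    rw [← h7 hy]
    exact le_sup_right
  · have h1 := hBB
    simp only [dingInvariant] at h1
    simp only [sq]
    linarith
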